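/- Let $K$ be an arbitrary algebraically closed field, let $W\subset K^n$ be an affine variety (a Zariski closed subset, possibly reducible), and let $f\colon K^2\times W\to K^m$ be a generically finite polynomial mapping of degree $d$. Then the set $S_f$ is empty, or it is an affine variety whose degree of $K$-uniruledness is at most $d$. Here the following terminology is used. The degree of $f$ is the least $d$ such that $f$ is the restriction of a mapping $K^2\times K^n\to K^m$ whose coordinates are polynomials of total degree at most $d$. The mapping $f$ is generically finite if it has finite fibres on some dense Zariski open subset of $X=K^2\times W$ (equivalently, for every irreducible component $X_i$ of $X$, the general fibre of $f|_{X_i}\colon X_i\to\overline{f(X_i)}$ is finite). The mapping $f$ is proper at $y\in\overline{f(X)}$ if $y$ has an affine Zariski open neighbourhood $U$ in $\overline{f(X)}$ such that $f^{-1}(U)$ is affine and $f|_{f^{-1}(U)}\colon f^{-1}(U)\to U$ is finite, that is, $K[f^{-1}(U)]$ is integral over $K[U]$; $S_f$ is the set of points of $\overline{f(X)}$ at which $f$ is not proper. A parametric curve of degree at most $d$ is an affine curve $\Gamma\subset K^m$ for which there is a dominant mapping $K\to\Gamma$ given by polynomials of degree at most $d$. An affine variety $S\subset K^m$ has degree of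 $K$-uniruledness at most $d$ if, for every irreducible component $Z$ of $S$ and every point $x\in Z$, there is a parametric curve of degree at most $d$ that passes through $x$ and is contained in $Z$. -/

import Mathlib

open MvPolynomial

namespace AffineGeometry

variable {K σ τ : Type*} [Field K]

/-- Affine varieties in `K^σ` (possibly reducible): the zero loci of ideals of polynomials. -/
def IsAffineVariety (X : Set (σ → K)) : Prop :=
  ∃ I : Ideal (MvPolynomial σ K), X = zeroLocus K I

/-- The Zariski closure of a subset of `K^σ`. -/
def zariskiClosure (S : Set (σ → K)) : Set (σ → K) :=
  zeroLocus K (vanishingIdeal K S)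

/-- `U` is a Zariski open subset of `X`. -/
def IsOpenIn (X U : Set (σ → K)) : Prop :=
  ∃ C : Set (σ → K), IsAffineVariety C ∧ U = X \ C

/-- Irreducible affine varieties: nonempty, and not a union of two proper closed subsets. -/
def IsIrreducibleVariety (Z : Set (σ → K)) : Prop :=
  IsAffineVariety Z ∧ Z.Nonempty ∧
    ∀ A B : Set (σ → K), IsAffineVariety A → IsAffineVariety B → Z ⊆ A ∪ B → Z ⊆ A ∨ Z ⊆ B

/-- `Z` is an irreducible component of `X`. -/
def IsComponent (X Z : Set (σ → K)) : Prop :=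
  Maximal (fun T : Set (σ → K) => IsIrreducibleVariety T ∧ T ⊆ X) Z

/-- `g : V → K` is regular: locally in the Zariski topology of `V` a quotient of polynomials. -/
def IsRegular (V : Set (σ → K)) (g : V → K) : Prop :=
  ∀ x : V, ∃ p q : MvPolynomial σ K, eval x.1 q ≠ 0 ∧
    ∀ z : V, eval z.1 q ≠ 0 → g z = eval z.1 p / eval z.1 q

/-- The ring `K[V]` of regular functions on a subset `V` of `K^σ` with its Zariski topology. -/
def regularFunctions (V : Set (σ → K)) : Subring (V → K) where
  carrier := {g | IsRegular V g}
  zero_mem' := fun x => ⟨0, 1, by simp, by simp⟩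
  one_mem' := fun x => ⟨1, 1, by simp, by simp⟩
  add_mem' := by
    intro a b ha hb x
    obtain ⟨p, q, hq, h⟩ := ha x
    obtain ⟨p', q', hq', h'⟩ := hb x
    refine ⟨p * q' + q * p', q * q', by simp [hq, hq'], fun z hz => ?_⟩
    have h1 : eval z.1 q ≠ 0 := fun h0 => hz (by simp [h0])
    have h2 : eval z.1 q' ≠ 0 := fun h0 => hz (by simp [h0])
    rw [Pi.add_apply, h z h1, h' z h2, div_add_div _ _ h1 h2]
    simp
  mul_mem' := by
    intro a b ha hb x
    obtain ⟨p, q, hq, h⟩ := ha x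
    obtain ⟨p', q', hq', h'⟩ := hb x
    refine ⟨p * p', q * q', by simp [hq, hq'], fun z hz => ?_⟩
    have h1 : eval z.1 q ≠ 0 := fun h0 => hz (by simp [h0])
    have h2 : eval z.1 q' ≠ 0 := fun h0 => hz (by simp [h0])
    rw [Pi.mul_apply, h z h1, h' z h2, div_mul_div_comm]
    simp
  neg_mem' := by
    intro a ha x
    obtain ⟨p, q, hq, h⟩ := ha x
    refine ⟨-p, q, hq, fun z hz => ?_⟩
    rw [Pi.neg_apply, h z hz, map_neg, neg_div]

/-- `V` (an open subset of an affine variety) is affine: it is biregularly isomorphic to a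
closed subvariety of some affine space. -/
def IsAffine (V : Set (σ → K)) : Prop :=
  ∃ (N : ℕ) (Z : Set (Fin N → K)) (e : V ≃ Z), IsAffineVariety Z ∧
    (∀ i, IsRegular V fun x => (e x).1 i) ∧ (∀ j, IsRegular Z fun z => (e.symm z).1 j)

/-- The degree of `f` restricted to `X` is `d`: `f` is given on `X` by polynomials of degree
at most `d`, and `d` is least with this property. -/
def IsPolynomialMapOfDegree (X : Set (σ → K)) (f : (σ → K) → (τ → K)) (d : ℕ) : Prop :=
  IsLeast {e : ℕ | ∃ P : τ → MvPolynomial σ K,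
    (∀ j, (P j).totalDegree ≤ e) ∧ ∀ x ∈ X, ∀ j, f x j = eval x (P j)} d

/-- `f : X → K^τ` is generically finite: it has finite fibres on a dense Zariski open subset
of `X`. For irreducible `X` this says that the general fibre of `X → closure (f X)` is finite,
and for reducible `X` that `f` is generically finite on each irreducible component. -/
def IsGenericallyFinite (X : Set (σ → K)) (f : (σ → K) → (τ → K)) : Prop :=
  ∃ U : Set (σ → K), IsOpenIn X U ∧ X ⊆ zariskiClosure U ∧
    ∀ y : τ → K, {x | x ∈ U ∧ f x = y}.Finite

/-- The pullback `g ↦ g ∘ f` of functions along `f : X ∩ f⁻¹(U) → U`. -/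
def pullback (X : Set (σ → K)) (f : (σ → K) → (τ → K)) (U : Set (τ → K)) :
    (U → K) →+* (↥(X ∩ f ⁻¹' U) → K) where
  toFun g := fun x => g ⟨f x.1, x.2.2⟩
  map_one' := rfl
  map_mul' _ _ := rfl
  map_zero' := rfl
  map_add' _ _ := rfl

/-- `f : X ∩ f⁻¹(U) → U` is finite: both sides are affine and `K[X ∩ f⁻¹(U)]` is integral over
`K[U]` through the pullback. -/
def IsFiniteOver (X : Set (σ → K)) (f : (σ → K) → (τ → K)) (U : Set (τ → K)) : Prop :=
  IsAffine U ∧ IsAffine (X ∩ f ⁻¹' U) ∧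
    ∀ φ ∈ regularFunctions (X ∩ f ⁻¹' U),
      ((pullback X f U).comp (regularFunctions U).subtype).IsIntegralElem φ

/-- `f : X → K^τ` is proper at `y`, a point of the closure of `f X`: it is finite over some
Zariski open neighbourhood of `y` in that closure (over which it is automatically dominant). -/
def IsProperAt (X : Set (σ → K)) (f : (σ → K) → (τ → K)) (y : τ → K) : Prop :=
  ∃ U : Set (τ → K), IsOpenIn (zariskiClosure (f '' X)) U ∧ y ∈ U ∧ IsFiniteOver X f U

/-- The set `S_f` of points of the closure of `f X` at which `f : X → K^τ` is not proper. -/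
def nonPropernessSet (X : Set (σ → K)) (f : (σ → K) → (τ → K)) : Set (τ → K) :=
  {y | y ∈ zariskiClosure (f '' X) ∧ ¬ IsProperAt X f y}

/-- Parametric curves of degree at most `d`: closures of images of nonconstant polynomial maps
`K → K^σ` of degree at most `d`. -/
def IsParametricCurve (d : ℕ) (Γ : Set (σ → K)) : Prop :=
  ∃ φ : σ → Polynomial K, (∀ i, (φ i).natDegree ≤ d) ∧ (∃ i, 0 < (φ i).natDegree) ∧
    Γ = zariskiClosure (Set.range fun (t : K) (i : σ) => (φ i).eval t)

/-- The affine variety `X` has degree of `K`-uniruledness at most `d`: through every point of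
every irreducible component there passes a parametric curve of degree at most `d` that is
contained in this component. -/
def HasUniruledDegreeLE (X : Set (σ → K)) (d : ℕ) : Prop :=
  IsAffineVariety X ∧ ∀ Z, IsComponent X Z → ∀ x ∈ Z, ∃ Γ, IsParametricCurve d Γ ∧ x ∈ Γ ∧ Γ ⊆ Z

/-- The cylinder `K² × W` in `K² × K^n`. -/
def cylinder {n : ℕ} (W : Set (Fin n → K)) : Set (Fin 2 ⊕ Fin n → K) :=
  {x | (fun i => x (Sum.inr i)) ∈ W}

end AffineGeometry

/-!
Let `X = K² × W` and let `Z` be an irreducible component of the set `S_f` of points at which `f` is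
not proper, with prime ideal `p` in the polynomial ring `R` of the target. Properness of `f` at `y`
means that every coordinate function of `X` is integral over the local ring of `y`
(`exists_relation_of_isProperAt`, `isProperAt_of_relations`). Hence some coordinate `x_i` is not
integral over the local ring of `Z`, on some component of `X`, and there is a valuation ring `O` of
an algebraically closed field `F` and a generic `F`-point `a` of that component such that `f(a)` is
integral over `O` with center `p`, while `a_i` is a pole (`exists_valuationSubring_pole`). In
other words, `a` tends to infinity while `f(a)` tends to the generic point of `Z`.

One of the two axes of `K²` is not the `i`-th one. The line through `a` in its direction lies in
`X`, its `i`-th coordinate is the constant `a_i`, and `f` is nonconstant on it because `f` is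
generically finite (`exists_coeff_notMem`). Its image is a polynomial curve of degree at most `d`.
Scaling the parameter makes the curve integral with nonconstant reduction
(`exists_integral_rescaling`). All points of the line are at infinity with respect to `O`, so the
reduced curve lies in `S_f`: the leading coefficient of an integral equation of `x_i` vanishes on it
(`residue_leadingCoeff_eq_zero`). As the reduced curve starts at the generic point of `Z`, and `Z`
is a component, the curve lies in `Z` (`exists_curve_in_component`).

Finally, a curve in `Z` through its generic point degenerates to a curve in `Z` through any given
point `x`: rescale and reduce once more, over a valuation ring with center `x`, and specialize the
coefficients to `K` by the Nullstellensatz (`exists_curve_through`).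
-/

namespace AffineGeometry

/-! ### Degeneration of polynomial curves over valuation rings -/

/-- A prime ideal containing the kernel of `ρ : R → F` is the center on `R` of some valuation ring
of the field `F`: the local ring of that prime maps to `F`, and a valuation ring dominates its
image. -/
theorem exists_valuationSubring_center {R F : Type*} [CommRing R] [Field F] (ρ : R →+* F)
    (P : Ideal R) [P.IsPrime] (h : RingHom.ker ρ ≤ P) :
    ∃ O : ValuationSubring F, (∀ r, ρ r ∈ O) ∧ ∀ r, r ∈ P ↔ O.valuation (ρ r) < 1 := by
  have hu : ∀ s : P.primeCompl, IsUnit (ρ s) := fun s =>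
    isUnit_iff_ne_zero.2 fun h0 => s.2 (h ((RingHom.mem_ker).2 h0))
  let g : Localization.AtPrime P →+* F := IsLocalization.lift hu
  have hg : ∀ r, g (algebraMap R _ r) = ρ r := fun r => IsLocalization.lift_eq hu r
  obtain ⟨O, hO, hloc⟩ := IsLocalRing.exists_factor_valuationRing g
  have hmem : ∀ r, ρ r ∈ O := fun r => hg r ▸ hO _
  refine ⟨O, hmem, fun r => ?_⟩
  have h1 : IsUnit (algebraMap R (Localization.AtPrime P) r) ↔ r ∉ P := by
    rw [IsLocalization.AtPrime.isUnit_to_map_iff (Localization.AtPrime P) P]; rfl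
  have h2 : IsUnit (g.codRestrict O.toSubring hO (algebraMap R _ r)) ↔
      IsUnit (algebraMap R (Localization.AtPrime P) r) :=
    ⟨fun hh => hloc.map_nonunit _ hh, fun hh => hh.map _⟩
  have h3 : IsUnit (g.codRestrict O.toSubring hO (algebraMap R _ r)) ↔
      O.valuation (ρ r) = 1 := by
    rw [← hg r]
    exact (ValuationSubring.valuation_eq_one_iff O ⟨g (algebraMap R _ r), hO _⟩)
  have h4 : O.valuation (ρ r) ≤ 1 := (O.valuation_le_one_iff _).2 (hmem r)
  rw [h4.lt_iff_ne, ne_eq, ← h3, h2, h1, not_not]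

/-- Over an algebraically closed valued field, finitely many weighted coefficients `a k` of
positive weights `e k`, not all zero, become integral and not all infinitesimal after a weighted
scaling. -/
theorem exists_scaling {F Γ ι : Type*} [Field F] [IsAlgClosed F]
    [LinearOrderedCommGroupWithZero Γ] (v : Valuation F Γ) (s : Finset ι) (a : ι → F) (e : ι → ℕ)
    (he : ∀ k ∈ s, 0 < e k) (ha : ∃ k ∈ s, a k ≠ 0) :
    ∃ c : F, (∀ k ∈ s, v (a k * c ^ e k) ≤ 1) ∧ ∃ k ∈ s, v (a k * c ^ e k) = 1 := by
  classical
  obtain ⟨k₁, hk₁, ha₁⟩ := ha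
  set N := ∏ k ∈ s, e k with hN
  have hN0 : 0 < N := Finset.prod_pos he
  have hdvd : ∀ k ∈ s, e k * (N / e k) = N := fun k hk =>
    Nat.mul_div_cancel' (Finset.dvd_prod_of_mem e hk)
  have hpos : ∀ k ∈ s, N / e k ≠ 0 := fun k hk h0 => by
    have := hdvd k hk; rw [h0] at this; omega
  -- the slopes `v (a k) ^ (1 / e k)` are compared after raising them to the power `N`
  obtain ⟨k₀, hk₀, hmax⟩ := s.exists_max_image (fun k => v (a k) ^ (N / e k)) ⟨k₁, hk₁⟩
  have ha₀ : a k₀ ≠ 0 := by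
    intro h0
    have := hmax k₁ hk₁
    rw [h0, map_zero, zero_pow (hpos _ hk₀), le_zero_iff, pow_eq_zero_iff (hpos _ hk₁)] at this
    exact ha₁ ((map_eq_zero v).1 this)
  obtain ⟨c, hc⟩ := IsAlgClosed.exists_pow_nat_eq (a k₀)⁻¹ (he k₀ hk₀)
  have h1 : v (a k₀ * c ^ e k₀) = 1 := by rw [hc, mul_inv_cancel₀ ha₀, map_one]
  refine ⟨c, fun k hk => ?_, k₀, hk₀, h1⟩
  · have key : v (a k * c ^ e k) ^ (N / e k) ≤ 1 := by
      calc v (a k * c ^ e k) ^ (N / e k) = v (a k) ^ (N / e k) * v c ^ N := by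
            rw [map_mul, map_pow, mul_pow, ← pow_mul, hdvd k hk]
        _ ≤ v (a k₀) ^ (N / e k₀) * v c ^ N := mul_le_mul_left (hmax k hk) _
        _ = v (a k₀ * c ^ e k₀) ^ (N / e k₀) := by
            rw [map_mul, map_pow, mul_pow, ← pow_mul, hdvd k₀ hk₀]
        _ = 1 := by rw [h1, one_pow]
    exact (pow_le_one_iff (hpos k hk)).1 key

/-- A nonconstant polynomial curve `w` over the fraction field of a valuation ring `O` whose
starting point is integral has a reparametrization `t ↦ c t` which is integral over `O` and whose
reduction to the residue field is still nonconstant. -/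
theorem exists_integral_rescaling {F τ : Type*} [Field F] [IsAlgClosed F] [Finite τ]
    (O : ValuationSubring F) (w : τ → Polynomial F) {d : ℕ} (hd : ∀ j, (w j).natDegree ≤ d)
    (hw : ∃ j, 0 < (w j).natDegree) (h0 : ∀ j, (w j).coeff 0 ∈ O) :
    ∃ (c : F) (w' : τ → Polynomial O),
      (∀ j, (w' j).map (algebraMap O F) = (w j).comp (Polynomial.C c * Polynomial.X)) ∧
      (∀ j, (w' j).natDegree ≤ d) ∧
      ∃ j, 0 < ((w' j).map (IsLocalRing.residue O)).natDegree := by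
  classical
  have := Fintype.ofFinite τ
  let s : Finset (τ × ℕ) := Finset.univ ×ˢ Finset.Icc 1 d
  obtain ⟨j₀, hj₀⟩ := hw
  have hs : ∀ k : τ × ℕ, k ∈ s ↔ 1 ≤ k.2 ∧ k.2 ≤ d := fun k => by simp [s]
  obtain ⟨c, hle, k, hk, hk1⟩ := exists_scaling O.valuation s
    (fun k => (w k.1).coeff k.2) (fun k => k.2) (fun k hk => ((hs k).1 hk).1)
    ⟨(j₀, (w j₀).natDegree), (hs _).2 ⟨hj₀, hd j₀⟩, by
      have : w j₀ ≠ 0 := by rintro h; rw [h] at hj₀; simp at hj₀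
      simpa using this⟩
  have hlift : ∀ j, (w j).comp (Polynomial.C c * Polynomial.X) ∈
      Polynomial.lifts (algebraMap O F) := by
    intro j
    rw [Polynomial.lifts_iff_coeff_lifts]
    intro i
    rw [Polynomial.comp_C_mul_X_coeff]
    suffices h : (w j).coeff i * c ^ i ∈ O from ⟨⟨_, h⟩, rfl⟩
    rcases Nat.eq_zero_or_pos i with rfl | hi
    · simpa using h0 j
    · by_cases hid : i ≤ d
      · exact (O.valuation_le_one_iff _).1 (hle (j, i) ((hs _).2 ⟨hi, hid⟩))
      · rw [Polynomial.coeff_eq_zero_of_natDegree_lt ((hd j).trans_lt (not_le.1 hid)), zero_mul]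
        exact O.zero_mem
  choose w' hw' using fun j => (Polynomial.mem_lifts _).1 (hlift j)
  refine ⟨c, w', hw', fun j => ?_, k.1, ?_⟩
  · rw [← Polynomial.natDegree_map_eq_of_injective (f := algebraMap O F) Subtype.val_injective,
      hw' j, Polynomial.natDegree_comp]
    refine (Nat.mul_le_mul_left _
      ((Polynomial.natDegree_C_mul_le c _).trans Polynomial.natDegree_X_le)).trans ?_
    simpa using hd j
  · have hcoe : (((w' k.1).coeff k.2 : O) : F) = (w k.1).coeff k.2 * c ^ k.2 := by
      rw [← Polynomial.comp_C_mul_X_coeff, ← hw' k.1, Polynomial.coeff_map]; rfl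
    have hunit : IsUnit ((w' k.1).coeff k.2) := by
      rw [ValuationSubring.valuation_eq_one_iff, hcoe, hk1]
    refine lt_of_lt_of_le ((hs k).1 hk).1 (Polynomial.le_natDegree_of_ne_zero ?_)
    rw [Polynomial.coeff_map]
    exact (hunit.map _).ne_zero


theorem aeval_polynomial_map {K A B τ : Type*} [CommRing K] [CommRing A] [CommRing B] [Algebra K A]
    [Algebra K B] (f : A →ₐ[K] B) (w : τ → Polynomial A) (g : MvPolynomial τ K) :
    aeval (fun j => (w j).map (f : A →+* B)) g = (aeval w g).map (f : A →+* B) :=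
  (comp_aeval_apply w (Polynomial.mapAlgHom f) g).symm

theorem aeval_polynomial_comp {K A τ : Type*} [CommRing K] [CommRing A] [Algebra K A]
    (q : Polynomial A) (w : τ → Polynomial A) (g : MvPolynomial τ K) :
    aeval (fun j => (w j).comp q) g = (aeval w g).comp q :=
  (comp_aeval_apply w ((Polynomial.aeval q).restrictScalars K) g).symm

/-- A nonconstant polynomial curve of degree at most `d` over an extension `κ` of `K` that lies in
the zero locus of `p` and starts at a `K`-point specializes to such a curve over `K`. These curves
are parametrized by an algebraic set over `K`, so this is the Nullstellensatz for the prime ideal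
of all relations over `K` between the coefficients of `u`. -/
theorem exists_specialization {K κ τ : Type*} [Field K] [IsAlgClosed K] [Field κ] [Algebra K κ]
    [Finite τ] {p : Ideal (MvPolynomial τ K)} (u : τ → Polynomial κ) {d : ℕ}
    (hd : ∀ j, (u j).natDegree ≤ d) (hu : ∃ j, 0 < (u j).natDegree)
    (hp : ∀ g ∈ p, aeval u g = 0) {x : τ → K}
    (hx : ∀ j, (u j).coeff 0 = algebraMap K κ (x j)) :
    ∃ φ : τ → Polynomial K, (∀ j, (φ j).natDegree ≤ d) ∧ (∃ j, 0 < (φ j).natDegree) ∧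
      (∀ j, (φ j).coeff 0 = x j) ∧ ∀ g ∈ p, aeval φ g = 0 := by
  classical
  obtain ⟨j₀, hj₀⟩ := hu
  let c : τ × Fin (d + 1) → κ := fun k => (u k.1).coeff k.2
  -- the universal family of polynomial curves of degree at most `d`
  let A : τ → Polynomial (MvPolynomial (τ × Fin (d + 1)) K) := fun j =>
    ∑ i : Fin (d + 1), Polynomial.C (X (j, i)) * Polynomial.X ^ (i : ℕ)
  have hAd : ∀ j, (A j).natDegree ≤ d := fun j =>
    Polynomial.natDegree_sum_le_of_forall_le _ _ fun i _ =>
      (Polynomial.natDegree_C_mul_X_pow_le _ _).trans (Nat.lt_succ_iff.1 i.2)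
  have hAc : ∀ j (i : Fin (d + 1)), (A j).coeff i = X (j, i) := by
    intro j i
    simp only [A, Polynomial.finsetSum_coeff, Polynomial.coeff_C_mul, Polynomial.coeff_X_pow]
    rw [Finset.sum_eq_single i]
    · simp
    · intro b _ hb
      rw [if_neg fun h => hb (Fin.ext h.symm), mul_zero]
    · simp
  have hAu : ∀ j, (A j).map (aeval c : MvPolynomial (τ × Fin (d + 1)) K →ₐ[K] κ) = u j := by
    intro j
    ext i
    rw [Polynomial.coeff_map]
    by_cases hi : i < d + 1
    · rw [hAc j ⟨i, hi⟩]
      exact aeval_X _ _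
    · rw [Polynomial.coeff_eq_zero_of_natDegree_lt ((hAd j).trans_lt (by omega)),
        Polynomial.coeff_eq_zero_of_natDegree_lt ((hd j).trans_lt (by omega)), map_zero]
  let P : Ideal (MvPolynomial (τ × Fin (d + 1)) K) :=
    RingHom.ker (aeval c : MvPolynomial (τ × Fin (d + 1)) K →ₐ[K] κ)
  have hPp : P.IsPrime := RingHom.ker_isPrime _
  let k₀ : τ × Fin (d + 1) := (j₀, ⟨(u j₀).natDegree, Nat.lt_succ_iff.2 (hd j₀)⟩)
  have hk₀ : X k₀ ∉ P := by
    intro h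
    have h1 : aeval c (X k₀ : MvPolynomial (τ × Fin (d + 1)) K) = 0 := h
    rw [aeval_X] at h1
    have h2 : (u j₀).leadingCoeff = 0 := h1
    rw [Polynomial.leadingCoeff_eq_zero] at h2
    simp [h2] at hj₀
  obtain ⟨a, haP, hak⟩ : ∃ a ∈ zeroLocus K P, a k₀ ≠ 0 := by
    by_contra! hcon
    apply hk₀
    rw [← IsPrime.vanishingIdeal_zeroLocus (K := K) P]
    intro a ha
    rw [aeval_X]
    exact hcon a ha
  refine ⟨fun j => (A j).map (aeval a : MvPolynomial (τ × Fin (d + 1)) K →ₐ[K] K),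
    fun j => Polynomial.natDegree_map_le.trans (hAd j), ⟨j₀, ?_⟩, fun j => ?_, fun g hg => ?_⟩
  · refine lt_of_lt_of_le hj₀ (Polynomial.le_natDegree_of_ne_zero ?_)
    rw [Polynomial.coeff_map, hAc j₀ k₀.2]
    simpa using hak
  · have hmem : X (j, 0) - C (x j) ∈ P := by
      rw [RingHom.mem_ker, map_sub, aeval_X, aeval_C, sub_eq_zero]
      exact hx j
    have := haP _ hmem
    rw [map_sub, aeval_X, aeval_C, sub_eq_zero] at this
    rw [Polynomial.coeff_map]
    have h0 := hAc j 0
    rw [Fin.val_zero] at h0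
    rw [h0]
    exact (aeval_X _ _).trans this
  · rw [aeval_polynomial_map]
    have h1 := aeval_polynomial_map (aeval c : MvPolynomial (τ × Fin (d + 1)) K →ₐ[K] κ) A g
    rw [funext hAu, hp g hg] at h1
    ext i
    rw [Polynomial.coeff_map, Polynomial.coeff_zero]
    refine haP _ ?_
    have h2 := congrArg (fun q => Polynomial.coeff q i) h1.symm
    simp only [Polynomial.coeff_map, Polynomial.coeff_zero] at h2
    exact h2

/-- The rescaling of `exists_integral_rescaling` when `O` contains `K`, together with the effect
on polynomial equations over `K`: the rescaled curve and its reduction satisfy those of `w`. The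
last clause says that the starting point of the reduced curve is the center of `O` with respect to
the starting point of `w`. -/
theorem exists_integral_model {K F τ : Type*} [Field K] [Field F] [IsAlgClosed F] [Algebra K F]
    [Finite τ] (O : ValuationSubring F) (w : τ → Polynomial F) {d : ℕ}
    (hd : ∀ j, (w j).natDegree ≤ d) (hw : ∃ j, 0 < (w j).natDegree)
    (h0 : ∀ g : MvPolynomial τ K, aeval (fun j => (w j).coeff 0) g ∈ O) :
    ∃ (_ : Algebra K O) (_ : IsScalarTower K O F) (c : F) (w' : τ → Polynomial O),
      (∀ g : MvPolynomial τ K, (aeval w' g).map (algebraMap O F) =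
        (aeval w g).comp (Polynomial.C c * Polynomial.X)) ∧
      (∀ g : MvPolynomial τ K, aeval (fun j => (w' j).map (IsLocalRing.residue O)) g =
        (aeval w' g).map (IsLocalRing.residue O)) ∧
      (∀ j, ((w' j).map (IsLocalRing.residue O)).natDegree ≤ d) ∧
      (∃ j, 0 < ((w' j).map (IsLocalRing.residue O)).natDegree) ∧
      ∀ g : MvPolynomial τ K,
        aeval (fun j => ((w' j).map (IsLocalRing.residue O)).coeff 0) g = 0 ↔
          O.valuation (aeval (fun j => (w j).coeff 0) g) < 1 := by
  obtain ⟨c, w', hw', hd', hpos⟩ := exists_integral_rescaling O w hd hw fun j => by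
    simpa using h0 (X j)
  let ι : K →+* O := (algebraMap K F).codRestrict O.toSubring fun k => by simpa using h0 (C k)
  let : Algebra K O := ι.toAlgebra
  have : IsScalarTower K O F := IsScalarTower.of_algebraMap_eq fun k => rfl
  let f : O →ₐ[K] F := IsScalarTower.toAlgHom K O F
  let r : O →ₐ[K] IsLocalRing.ResidueField O := IsScalarTower.toAlgHom K O _
  refine ⟨inferInstance, inferInstance, c, w', fun g => ?_, fun g => aeval_polynomial_map r w' g,
    fun j => Polynomial.natDegree_map_le.trans (hd' j), hpos, fun g => ?_⟩
  · rw [← aeval_polynomial_comp, ← funext hw']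
    exact (aeval_polynomial_map f w' g).symm
  · have h1 : aeval (fun j => ((w' j).map (IsLocalRing.residue O)).coeff 0) g =
        IsLocalRing.residue O (aeval (fun j => (w' j).coeff 0) g) := by
      simp only [Polynomial.coeff_map]
      exact (comp_aeval_apply _ r g).symm
    have h2 : ((aeval (fun j => (w' j).coeff 0) g : O) : F) =
        aeval (fun j => (w j).coeff 0) g := by
      refine (comp_aeval_apply _ f g).trans ?_
      have h3 : (fun j => f ((w' j).coeff 0)) = fun j => (w j).coeff 0 := by
        funext j
        have h4 := congrArg (fun q => Polynomial.coeff q 0) (hw' j)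
        simp only [Polynomial.coeff_map, Polynomial.comp_C_mul_X_coeff, pow_zero, mul_one] at h4
        exact h4
      rw [h3]
    rw [h1, IsLocalRing.residue_eq_zero_iff, ValuationSubring.valuation_lt_one_iff, h2]

/-- A nonconstant polynomial curve that lies in the zero locus of `p` and starts at a generic
point of it degenerates to a nonconstant polynomial curve of no larger degree through any given
point `x`: rescale over a valuation ring with center `x`, reduce, and specialize to `K`. -/
theorem exists_curve_of_isAlgClosed {K F τ : Type*} [Field K] [IsAlgClosed K] [Field F]
    [IsAlgClosed F] [Algebra K F] [Finite τ] {p : Ideal (MvPolynomial τ K)}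
    (w : τ → Polynomial F) {d : ℕ} (hd : ∀ j, (w j).natDegree ≤ d)
    (hw : ∃ j, 0 < (w j).natDegree) (hp : ∀ g ∈ p, aeval w g = 0)
    (hgen : ∀ g, aeval (fun j => (w j).coeff 0) g = 0 → g ∈ p)
    {x : τ → K} (hx : x ∈ zeroLocus K p) :
    ∃ φ : τ → Polynomial K, (∀ j, (φ j).natDegree ≤ d) ∧ (∃ j, 0 < (φ j).natDegree) ∧
      (∀ j, (φ j).coeff 0 = x j) ∧ ∀ g ∈ p, aeval φ g = 0 := by
  obtain ⟨O, hO, hcen⟩ := exists_valuationSubring_center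
    (aeval fun j => (w j).coeff 0 : MvPolynomial τ K →ₐ[K] F).toRingHom (vanishingIdeal K {x})
    fun g hg => fun y hy => by rw [Set.mem_singleton_iff.1 hy]; exact hx g (hgen g hg)
  obtain ⟨_, _, c, w', hmap, hres, hd', hpos, h0⟩ := exists_integral_model O w hd hw hO
  refine exists_specialization _ hd' hpos (fun g hg => ?_) fun j => ?_
  · have h1 : aeval w' g = 0 := by
      apply Polynomial.map_injective (algebraMap O F) Subtype.val_injective
      rw [hmap, hp g hg, Polynomial.zero_comp, Polynomial.map_zero]
    rw [hres, h1, Polynomial.map_zero]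
  · have h1 : X j - C (x j) ∈ vanishingIdeal K {x} := by
      rw [mem_vanishingIdeal_singleton_iff, map_sub, aeval_X, aeval_C]
      exact sub_self _
    have h2 := (h0 _).2 ((hcen _).1 h1)
    rwa [map_sub, aeval_X, aeval_C, sub_eq_zero] at h2

/-- The degeneration of curves starting at a generic point, over an arbitrary field extension. -/
theorem exists_curve_through {K κ τ : Type*} [Field K] [IsAlgClosed K] [Field κ]
    [Algebra K κ] [Finite τ] {p : Ideal (MvPolynomial τ K)}
    (w : τ → Polynomial κ) {d : ℕ} (hd : ∀ j, (w j).natDegree ≤ d)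
    (hw : ∃ j, 0 < (w j).natDegree) (hp : ∀ g ∈ p, aeval w g = 0)
    (hgen : ∀ g, aeval (fun j => (w j).coeff 0) g = 0 → g ∈ p)
    {x : τ → K} (hx : x ∈ zeroLocus K p) :
    ∃ φ : τ → Polynomial K, (∀ j, (φ j).natDegree ≤ d) ∧ (∃ j, 0 < (φ j).natDegree) ∧
      (∀ j, (φ j).coeff 0 = x j) ∧ ∀ g ∈ p, aeval φ g = 0 := by
  let f : κ →ₐ[K] AlgebraicClosure κ := IsScalarTower.toAlgHom K κ (AlgebraicClosure κ)
  have hf : Function.Injective (f : κ →+* AlgebraicClosure κ) := RingHom.injective _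
  refine exists_curve_of_isAlgClosed (fun j => (w j).map (f : κ →+* AlgebraicClosure κ)) (d := d)
    (fun j => Polynomial.natDegree_map_le.trans (hd j)) ?_ (fun g hg => ?_) (fun g hg => ?_) hx
  · simpa only [Polynomial.natDegree_map_eq_of_injective hf] using hw
  · rw [aeval_polynomial_map, hp g hg, Polynomial.map_zero]
  · refine hgen g (hf ?_)
    rw [map_zero, ← hg]
    simp only [Polynomial.coeff_map]
    exact comp_aeval_apply _ f g

/-- If every polynomial equation satisfied by `b` over `R` has its leading coefficient in `p`,
that is, if `b` is not integral over the localization of `R` at `p`, then some valuation ring with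
center `p` on `R` has `b` as a pole. The valuation ring comes from a prime ideal of `R[T]`, where
`T` is sent to `b⁻¹`, that contains `T` and contracts to `p`. -/
theorem exists_valuationSubring_pole {R F : Type*} [CommRing R] [Field F] (ρ : R →+* F)
    (p : Ideal R) [hp : p.IsPrime] (b : F)
    (hb : ∀ H : Polynomial R, H.eval₂ ρ b = 0 → H.leadingCoeff ∈ p) :
    ∃ O : ValuationSubring F, (∀ r, ρ r ∈ O) ∧ (∀ r, r ∈ p ↔ O.valuation (ρ r) < 1) ∧
      b ≠ 0 ∧ O.valuation b⁻¹ < 1 := by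
  have : Nontrivial R := ⟨⟨0, 1, fun h => hp.one_notMem (h ▸ p.zero_mem)⟩⟩
  have hb0 : b ≠ 0 := by
    rintro rfl
    have := hb Polynomial.X (Polynomial.eval₂_X _ _)
    rw [Polynomial.leadingCoeff_X] at this
    exact hp.one_notMem this
  let := invertibleOfNonzero hb0
  let Ψ : Polynomial R →+* F := Polynomial.eval₂RingHom ρ b⁻¹
  let J : Ideal (Polynomial R) := p.comap Polynomial.constantCoeff
  have hdisj : Disjoint ((RingHom.ker Ψ ⊔ J : Ideal (Polynomial R)) : Set (Polynomial R))
      (p.primeCompl.map (Polynomial.C : R →+* Polynomial R)) := by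
    rw [Set.disjoint_left]
    rintro G hG ⟨h, hh, rfl⟩
    obtain ⟨G₁, hG₁, G₂, hG₂, hsum⟩ := Submodule.mem_sup.1 hG
    have h0 : G₁.coeff 0 ∉ p := by
      intro h1
      have h2 : G₁.coeff 0 + G₂.coeff 0 = h := by
        rw [← Polynomial.coeff_add, hsum]
        exact Polynomial.coeff_C_zero
      exact hh (h2 ▸ p.add_mem h1 hG₂)
    -- clearing the powers of `b⁻¹` reverses the coefficients
    have h3 : (G₁.reverse).eval₂ ρ b = 0 := by
      have h4 : G₁.eval₂ ρ (⅟b) = 0 := by rw [invOf_eq_inv]; exact hG₁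
      let := invertibleInvOf (a := b)
      simpa using (Polynomial.eval₂_reverse_eq_zero_iff ρ (⅟b) G₁).2 h4
    have h5 := hb _ h3
    rw [Polynomial.reverse_leadingCoeff, Polynomial.trailingCoeff,
      Polynomial.natTrailingDegree_eq_zero.2
        (Or.inr fun h6 => h0 (by rw [h6]; exact p.zero_mem))] at h5
    exact h0 h5
  obtain ⟨P, hP, hle, hPd⟩ := Ideal.exists_le_prime_disjoint _ _ hdisj
  obtain ⟨O, hO, hcen⟩ := exists_valuationSubring_center Ψ P (le_sup_left.trans hle)
  have hC : ∀ r, Ψ (Polynomial.C r) = ρ r := fun r => Polynomial.eval₂_C _ _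
  have hX : Ψ Polynomial.X = b⁻¹ := Polynomial.eval₂_X _ _
  refine ⟨O, fun r => hC r ▸ hO _, fun r => ?_, hb0, ?_⟩
  · rw [← hC r, ← hcen]
    refine ⟨fun hr => hle (Ideal.mem_sup_right ?_), fun hr => ?_⟩
    · simpa [J] using hr
    · by_contra hrp
      exact Set.disjoint_left.1 hPd hr ⟨r, hrp, rfl⟩
  · rw [← hX, ← hcen]
    exact hle (Ideal.mem_sup_right (by simp [J]))

/-- If `b` is a pole of `O` and satisfies an equation with coefficients in `O[t]`, then the
leading coefficient of the equation reduces to zero: divide by the highest power of `b`. -/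
theorem residue_leadingCoeff_eq_zero {R F : Type*} [CommRing R] [Field F]
    (O : ValuationSubring F) (α : R →+* Polynomial O) (b : F) (hb0 : b ≠ 0)
    (hb : O.valuation b⁻¹ < 1) (H : Polynomial R)
    (hH : H.eval₂ ((Polynomial.mapRingHom (algebraMap O F)).comp α) (Polynomial.C b) = 0) :
    (α H.leadingCoeff).map (IsLocalRing.residue O) = 0 := by
  let u : O := ⟨b⁻¹, (O.valuation_le_one_iff _).1 hb.le⟩
  have hu : IsLocalRing.residue O u = 0 :=
    (IsLocalRing.residue_eq_zero_iff _).2 ((O.valuation_lt_one_iff u).2 hb)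
  let : Invertible (Polynomial.C b) :=
    ⟨Polynomial.C b⁻¹, by rw [← Polynomial.C_mul, inv_mul_cancel₀ hb0, Polynomial.C_1],
      by rw [← Polynomial.C_mul, mul_inv_cancel₀ hb0, Polynomial.C_1]⟩
  have h1 : H.reverse.eval₂ ((Polynomial.mapRingHom (algebraMap O F)).comp α)
      (Polynomial.C b⁻¹) = 0 := (Polynomial.eval₂_reverse_eq_zero_iff _ (Polynomial.C b) H).2 hH
  have h2 : H.reverse.eval₂ α (Polynomial.C u) = 0 := by
    apply Polynomial.map_injective (algebraMap O F) Subtype.val_injective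
    have h3 := Polynomial.hom_eval₂ H.reverse α (Polynomial.mapRingHom (algebraMap O F))
      (Polynomial.C u)
    rw [Polynomial.coe_mapRingHom, Polynomial.map_C] at h3
    rw [h3, Polynomial.map_zero]
    exact h1
  have h4 := Polynomial.hom_eval₂ H.reverse α
    (Polynomial.mapRingHom (IsLocalRing.residue O)) (Polynomial.C u)
  rw [h2, map_zero, Polynomial.coe_mapRingHom, Polynomial.map_C, hu, Polynomial.C_0,
    Polynomial.eval₂_at_zero, Polynomial.coeff_zero_reverse] at h4
  exact h4.symm

/-! ### Properness and integral equations of the coordinates -/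

variable {K σ τ : Type*} [Field K]

/-- The principal open set `g ≠ 0` of `X` is affine: it is the closed set `z * g(x) = 1` over `X`.
-/
theorem isAffine_principalOpen [Finite σ] {X : Set (σ → K)} (hX : IsAffineVariety X)
    (g : MvPolynomial σ K) : IsAffine {x | x ∈ X ∧ eval x g ≠ 0} := by
  obtain ⟨I, rfl⟩ := hX
  obtain ⟨N, ⟨e₀⟩⟩ := Finite.exists_equiv_fin (Option σ)
  let r : (Fin N → K) → (σ → K) := fun z i => z (e₀ (some i))
  let ren : MvPolynomial σ K →ₐ[K] MvPolynomial (Fin N) K := rename fun i => e₀ (some i)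
  have hren : ∀ z p, eval z (ren p) = eval (r z) p := fun z p => eval_rename _ _ _
  let Z : Set (Fin N → K) := {z | r z ∈ zeroLocus K I ∧ z (e₀ none) * eval (r z) g = 1}
  have hne : ∀ z : Z, eval (r z.1) g ≠ 0 := fun z h => by simpa [h] using z.2.2
  let up : {x | x ∈ zeroLocus K I ∧ eval x g ≠ 0} → (Fin N → K) := fun x k =>
    (e₀.symm k).elim (eval x.1 g)⁻¹ x.1
  have hr : ∀ x, r (up x) = x.1 := fun x => by funext i; simp [r, up]
  have hup : ∀ x, up x (e₀ none) = (eval x.1 g)⁻¹ := fun x => by simp [up]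
  let e : {x | x ∈ zeroLocus K I ∧ eval x g ≠ 0} ≃ Z :=
    { toFun := fun x => ⟨up x, by
        refine ⟨by rw [hr]; exact x.2.1, ?_⟩
        rw [hr, hup, inv_mul_cancel₀ x.2.2]⟩
      invFun := fun z => ⟨r z.1, z.2.1, hne z⟩
      left_inv := fun x => Subtype.ext (hr x)
      right_inv := fun z => by
        apply Subtype.ext
        funext k
        obtain ⟨o, rfl⟩ := e₀.surjective k
        cases o with
        | none =>
          exact (hup _).trans (eq_inv_of_mul_eq_one_left z.2.2).symm
        | some i => simp [up, r] }
  refine ⟨N, Z, e, ?_, fun k x => ?_, fun i z => ?_⟩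
  · refine ⟨Ideal.span (ren '' I ∪ {X (e₀ none) * ren g - 1}), ?_⟩
    rw [zeroLocus_span]
    ext z
    simp only [Set.mem_ofPred_eq, Z]
    constructor
    · rintro ⟨h1, h2⟩ q (⟨p, hp, rfl⟩ | rfl)
      · exact (hren z p).trans (h1 p hp)
      · change eval z _ = 0
        rw [map_sub, map_mul, eval_X, hren, h2, map_one, sub_self]
    · intro h
      refine ⟨fun p hp => ((hren z p).symm.trans (h _ (Or.inl ⟨p, hp, rfl⟩)) :), ?_⟩
      have h2 : eval z _ = 0 := h _ (Or.inr rfl)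
      rwa [map_sub, map_mul, eval_X, hren, map_one, sub_eq_zero] at h2
  · obtain ⟨o, rfl⟩ := e₀.surjective k
    cases o with
    | none => exact ⟨1, g, x.2.2, fun z _ => by rw [map_one, one_div]; exact hup z⟩
    | some i => exact ⟨X i, 1, by simp, fun z _ => by simp [e, up]⟩
  · exact ⟨X (e₀ (some i)), 1, by simp, fun z _ => by simp [e, r]⟩

theorem exists_mul_eq_of_isRegular {V : Set (σ → K)} {φ : V → K} (hφ : IsRegular V φ) (x : V) :
    ∃ q G : MvPolynomial σ K, eval x.1 q ≠ 0 ∧ ∀ z : V, eval z.1 q * φ z = eval z.1 G := by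
  obtain ⟨p, q, hq, h⟩ := hφ x
  -- squaring the denominator extends the identity to the zeros of `q`
  refine ⟨q * q, p * q, by simpa using hq, fun z => ?_⟩
  by_cases hz : eval z.1 q = 0
  · simp [hz]
  · rw [h z hz]
    simp only [map_mul]
    field_simp

/-- Regular functions on the principal open set `g ≠ 0` of `X` are of the form `G / g ^ k`: by the
Nullstellensatz, the ideal of denominators contains a power of `g`. -/
theorem exists_pow_mul_eq_of_isRegular [IsAlgClosed K] [Finite σ] {X : Set (σ → K)}
    (hX : IsAffineVariety X) (g : MvPolynomial σ K) {V : Set (σ → K)}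
    (hV : V = {x | x ∈ X ∧ eval x g ≠ 0}) {φ : V → K} (hφ : IsRegular V φ) :
    ∃ (k : ℕ) (G : MvPolynomial σ K), ∀ z : V, eval z.1 g ^ k * φ z = eval z.1 G := by
  -- the ideal of denominators of `φ`
  let J : Ideal (MvPolynomial σ K) :=
    { carrier := {q | ∃ G : MvPolynomial σ K, ∀ z : V, eval z.1 q * φ z = eval z.1 G}
      zero_mem' := ⟨0, by simp⟩
      add_mem' := by
        rintro a b ⟨G, hG⟩ ⟨G', hG'⟩
        exact ⟨G + G', fun z => by rw [map_add, map_add, add_mul, hG, hG']⟩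
      smul_mem' := by
        rintro a b ⟨G, hG⟩
        exact ⟨a * G, fun z => by rw [smul_eq_mul, map_mul, map_mul, mul_assoc, hG]⟩ }
  obtain ⟨I, rfl⟩ := hX
  have hg : g ∈ J.radical := by
    rw [← vanishingIdeal_zeroLocus_eq_radical (K := K)]
    intro x hx
    by_contra hgx
    have hxI : x ∈ zeroLocus K I := fun p hp => hx p ⟨0, fun z => by
      have hz : z.1 ∈ {x | x ∈ zeroLocus K I ∧ eval x g ≠ 0} := hV ▸ z.2
      have : eval z.1 p = 0 := hz.1 p hp
      rw [this, zero_mul, map_zero]⟩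
    have hxV : x ∈ V := by rw [hV]; exact ⟨hxI, hgx⟩
    obtain ⟨q, G, hq, h⟩ := exists_mul_eq_of_isRegular hφ ⟨x, hxV⟩
    exact hq (hx q ⟨G, h⟩)
  obtain ⟨k, G, hG⟩ := hg
  exact ⟨k, G, fun z => by rw [← hG z, map_pow]⟩

theorem subset_zariskiClosure (S : Set (σ → K)) : S ⊆ zariskiClosure S :=
  zeroLocus_vanishingIdeal_le S

/-- The polynomials `H(y, t)` with `H(f(x), x_i) = 0` on `X`, for the map `f` with coordinates
`P`. -/
noncomputable def relations (X : Set (σ → K)) (P : τ → MvPolynomial σ K) (i : σ) :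
    Ideal (Polynomial (MvPolynomial τ K)) :=
  (vanishingIdeal K X).comap
    (Polynomial.eval₂RingHom (aeval P : MvPolynomial τ K →ₐ[K] MvPolynomial σ K).toRingHom
      (MvPolynomial.X i))

theorem eval_aeval_eq {X : Set (σ → K)} {f : (σ → K) → (τ → K)} {P : τ → MvPolynomial σ K}
    (hP : ∀ x ∈ X, ∀ j, f x j = eval x (P j)) {x : σ → K} (hx : x ∈ X) (g : MvPolynomial τ K) :
    eval x (aeval P g) = eval (f x) g := by
  have h : f x = fun j => eval x (P j) := funext (hP x hx)
  rw [h]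
  exact comp_aeval_apply P (aeval x : MvPolynomial σ K →ₐ[K] K) g

theorem mem_relations {X : Set (σ → K)} {f : (σ → K) → (τ → K)} {P : τ → MvPolynomial σ K}
    (hP : ∀ x ∈ X, ∀ j, f x j = eval x (P j)) {i : σ} {H : Polynomial (MvPolynomial τ K)} :
    H ∈ relations X P i ↔ ∀ x ∈ X, H.eval₂ (eval (f x)) (x i) = 0 := by
  refine forall₂_congr fun x hx => ?_
  have h : eval x (H.eval₂ (aeval P : MvPolynomial τ K →ₐ[K] MvPolynomial σ K).toRingHom
      (MvPolynomial.X i)) = H.eval₂ (eval (f x)) (x i) := by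
    rw [Polynomial.hom_eval₂, eval_X]
    congr 1
    exact RingHom.ext fun g => eval_aeval_eq hP hx g
  rw [← h]
  rfl

/-- Where `f` is proper, every coordinate of the source is integral over the local ring of the
target. -/
theorem exists_relation_of_isProperAt {X : Set (σ → K)} {f : (σ → K) → (τ → K)}
    {P : τ → MvPolynomial σ K} (hP : ∀ x ∈ X, ∀ j, f x j = eval x (P j)) {y : τ → K}
    (hy : IsProperAt X f y) (i : σ) :
    ∃ H ∈ relations X P i, eval y H.leadingCoeff ≠ 0 := by
  obtain ⟨U, ⟨C, ⟨I, rfl⟩, hU⟩, hyU, -, -, hint⟩ := hy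
  have hyI : y ∉ zeroLocus K I := by rw [hU] at hyU; exact hyU.2
  obtain ⟨c, hcI, hcy⟩ : ∃ c ∈ I, eval y c ≠ 0 := by
    by_contra! h
    exact hyI h
  obtain ⟨M, hM, hM0⟩ := hint (fun x => x.1 i) fun x =>
    ⟨MvPolynomial.X i, 1, by simp, fun z _ => by simp⟩
  set n := M.natDegree
  choose q G hq hG using fun j => exists_mul_eq_of_isRegular (M.coeff j).2 ⟨y, hyU⟩
  -- a common denominator of the coefficients
  let Q : MvPolynomial τ K := ∏ j ∈ Finset.range (n + 1), q j
  have hQ : ∀ j, ∃ A : MvPolynomial τ K, j ∈ Finset.range (n + 1) →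
      ∀ z : U, eval z.1 A = eval z.1 Q * (M.coeff j).1 z := by
    intro j
    by_cases hj : j ∈ Finset.range (n + 1)
    · refine ⟨(∏ l ∈ (Finset.range (n + 1)).erase j, q l) * G j, fun _ z => ?_⟩
      rw [map_mul, ← hG, ← mul_assoc, ← map_mul, Finset.prod_erase_mul _ _ hj]
    · exact ⟨0, fun h => absurd h hj⟩
  choose A hA using hQ
  let H : Polynomial (MvPolynomial τ K) :=
    ∑ j ∈ Finset.range (n + 1), Polynomial.C (c * A j) * Polynomial.X ^ j
  have hHn : H.coeff n = c * A n := by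
    simp only [H, Polynomial.finsetSum_coeff, Polynomial.coeff_C_mul_X_pow]
    simp
  have hHd : H.natDegree ≤ n := Polynomial.natDegree_sum_le_of_forall_le _ _ fun j hj =>
    (Polynomial.natDegree_C_mul_X_pow_le _ _).trans (Nat.lt_succ_iff.1 (Finset.mem_range.1 hj))
  have hHy : eval y (H.coeff n) ≠ 0 := by
    have h1 : (M.coeff n).1 = 1 := congrArg Subtype.val hM.coeff_natDegree
    have h2 := hA n (Finset.self_mem_range_succ n) ⟨y, hyU⟩
    rw [h1, Pi.one_apply, mul_one] at h2
    rw [hHn, map_mul, h2, map_prod]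
    exact mul_ne_zero hcy (Finset.prod_ne_zero_iff.2 fun j _ => hq j)
  refine ⟨H, (mem_relations hP).2 fun x hx => ?_, ?_⟩
  · have hev : H.eval₂ (eval (f x)) (x i) =
        eval (f x) c * ∑ j ∈ Finset.range (n + 1), eval (f x) (A j) * x i ^ j := by
      simp only [H, Polynomial.eval₂_finsetSum, Polynomial.eval₂_mul, Polynomial.eval₂_C,
        Polynomial.eval₂_pow, Polynomial.eval₂_X, map_mul, Finset.mul_sum, mul_assoc]
    rw [hev]
    by_cases hfx : f x ∈ U
    · have h1 := congrFun hM0 ⟨x, hx, hfx⟩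
      rw [Polynomial.eval₂_eq_sum_range, Finset.sum_apply] at h1
      have h2 : ∑ j ∈ Finset.range (n + 1), eval (f x) (A j) * x i ^ j =
          eval (f x) Q * ∑ j ∈ Finset.range (n + 1), (M.coeff j).1 ⟨f x, hfx⟩ * x i ^ j := by
        rw [Finset.mul_sum]
        refine Finset.sum_congr rfl fun j hj => ?_
        rw [hA j hj ⟨f x, hfx⟩, mul_assoc]
      have h3 : ∑ j ∈ Finset.range (n + 1), (M.coeff j).1 ⟨f x, hfx⟩ * x i ^ j = 0 := h1
      rw [h2, h3, mul_zero, mul_zero]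
    · have hfxI : f x ∈ zeroLocus K I := by
        by_contra h
        exact hfx (hU ▸ ⟨subset_zariskiClosure _ ⟨x, hx, rfl⟩, h⟩)
      have : eval (f x) c = 0 := hfxI c hcI
      rw [this, zero_mul]
  · have hn : H.natDegree = n := le_antisymm hHd
      (Polynomial.le_natDegree_of_ne_zero fun h => hHy (by rw [h, map_zero]))
    rw [Polynomial.leadingCoeff, hn]
    exact hHy

/-- If every coordinate of the source is integral over the local ring of the target at `y`, then
`f` is finite over the principal open set where no leading coefficient of the equations vanishes.
-/
theorem isProperAt_of_relations [IsAlgClosed K] [Finite σ] [Finite τ] {X : Set (σ → K)}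
    (hX : IsAffineVariety X) {f : (σ → K) → (τ → K)}
    {P : τ → MvPolynomial σ K} (hP : ∀ x ∈ X, ∀ j, f x j = eval x (P j)) {y : τ → K}
    (hy : y ∈ zariskiClosure (f '' X))
    (H : ∀ i, ∃ H ∈ relations X P i, eval y H.leadingCoeff ≠ 0) : IsProperAt X f y := by
  classical
  have := Fintype.ofFinite σ
  choose H hH hHy using H
  let h : MvPolynomial τ K := ∏ i, (H i).leadingCoeff
  let Y := zariskiClosure (f '' X)
  let U : Set (τ → K) := {z | z ∈ Y ∧ eval z h ≠ 0}
  let g : MvPolynomial σ K := aeval P h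
  have hg : ∀ x ∈ X, eval x g = eval (f x) h := fun x hx => eval_aeval_eq hP hx h
  have hfU : X ∩ f ⁻¹' U = {x | x ∈ X ∧ eval x g ≠ 0} := by
    ext x
    refine ⟨fun ⟨h1, h2⟩ => ⟨h1, by rw [hg x h1]; exact h2.2⟩, fun ⟨h1, h2⟩ =>
      ⟨h1, subset_zariskiClosure _ ⟨x, h1, rfl⟩, by rw [← hg x h1]; exact h2⟩⟩
  have hyU : y ∈ U := ⟨hy, by
    rw [map_prod]
    exact Finset.prod_ne_zero_iff.2 fun i _ => hHy i⟩
  refine ⟨U, ⟨zeroLocus K (Ideal.span {h}), ⟨_, rfl⟩, ?_⟩, hyU,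
    isAffine_principalOpen ⟨_, rfl⟩ h, ?_, fun φ hφ => ?_⟩
  · rw [zeroLocus_span]
    ext z
    simp only [Set.mem_singleton_iff, forall_eq, Set.mem_sdiff, Set.mem_ofPred_eq, U, Y]
    rfl
  · rw [hfU]
    exact isAffine_principalOpen hX g
  set ψ := (pullback X f U).comp (regularFunctions U).subtype
  have hpoly : ∀ a : MvPolynomial τ K, (fun z : U => eval z.1 a) ∈ regularFunctions U :=
    fun a z => ⟨a, 1, by simp, by simp⟩
  have hinv : ∀ a : MvPolynomial τ K, (∀ z : U, eval z.1 a ≠ 0) →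
      (fun z : U => (eval z.1 a)⁻¹) ∈ regularFunctions U :=
    fun a ha z => ⟨1, a, ha z, by simp⟩
  -- the coordinate functions are integral because the leading coefficients divide `h`
  have hcoord : ∀ i, ψ.IsIntegralElem fun x => x.1 i := by
    intro i
    have hlc : ∀ z : U, eval z.1 (H i).leadingCoeff ≠ 0 := fun z h0 => z.2.2 (by
      rw [map_prod]
      exact Finset.prod_eq_zero (Finset.mem_univ i) h0)
    let ε : MvPolynomial τ K →+* regularFunctions U :=
      { toFun := fun a => ⟨_, hpoly a⟩
        map_one' := by ext; simp
        map_mul' := fun _ _ => by ext; simp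
        map_zero' := by ext; simp
        map_add' := fun _ _ => by ext; simp }
    have hunit : (⟨_, hinv _ hlc⟩ : regularFunctions U) * ε (H i).leadingCoeff = 1 := by
      ext z
      exact inv_mul_cancel₀ (hlc z)
    refine ⟨Polynomial.C ⟨_, hinv _ hlc⟩ * (H i).map ε, ?_, ?_⟩
    · refine Polynomial.monic_C_mul_of_mul_leadingCoeff_eq_one ?_
      rw [Polynomial.leadingCoeff_map_of_leadingCoeff_ne_zero, hunit]
      intro h0
      rw [h0, mul_zero] at hunit
      exact zero_ne_one (congrFun (congrArg Subtype.val hunit) ⟨y, hyU⟩)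
    · rw [Polynomial.eval₂_mul, Polynomial.eval₂_map]
      have h0 : (H i).eval₂ (ψ.comp ε) (fun x : ↥(X ∩ f ⁻¹' U) => x.1 i) = 0 := by
        funext x
        have h1 := (mem_relations hP).1 (hH i) x.1 x.2.1
        have h2 := Polynomial.hom_eval₂ (H i) (ψ.comp ε)
          (Pi.evalRingHom (fun _ : ↥(X ∩ f ⁻¹' U) => K) x) (fun x => x.1 i)
        exact h2.trans h1
      rw [h0, mul_zero]
  have hregpoly : ∀ G : MvPolynomial σ K,
      ψ.IsIntegralElem fun x : ↥(X ∩ f ⁻¹' U) => eval x.1 G := by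
    intro G
    induction G using MvPolynomial.induction_on with
    | C a =>
      have : (fun x : ↥(X ∩ f ⁻¹' U) => eval x.1 (C a)) = ψ ⟨_, hpoly (C a)⟩ := by
        funext x
        rw [eval_C]
        exact (eval_C a).symm
      rw [this]
      exact ψ.isIntegralElem_map
    | add p q hp hq =>
      simp only [map_add]
      exact hp.add _ hq
    | mul_X p i hp =>
      simp only [map_mul, eval_X]
      exact hp.mul _ (hcoord i)
  obtain ⟨k, G, hG⟩ := exists_pow_mul_eq_of_isRegular hX g hfU hφ
  have hφ' : φ = ψ ⟨_, hinv (h ^ k) fun z => by rw [map_pow]; exact pow_ne_zero _ z.2.2⟩ *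
      fun x : ↥(X ∩ f ⁻¹' U) => eval x.1 G := by
    funext x
    have h1 : eval x.1 g ^ k ≠ 0 := by
      rw [hg _ x.2.1]
      exact pow_ne_zero _ x.2.2.2
    have h2 : eval (f x.1) (h ^ k) = eval x.1 g ^ k := by rw [hg _ x.2.1, map_pow]
    refine (eq_inv_mul_iff_mul_eq₀ ?_).2 ?_
    · exact h2 ▸ h1
    · exact (congrArg (· * φ x) h2).trans (hG x)
  rw [hφ']
  exact ψ.isIntegralElem_map.mul _ (hregpoly G)

/-! ### Components and the set of non-properness -/

/-- The set of non-properness is closed, since properness at `y` is defined by an open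
neighbourhood of `y`. -/
theorem isAffineVariety_nonPropernessSet (X : Set (σ → K)) (f : (σ → K) → (τ → K)) :
    IsAffineVariety (nonPropernessSet X f) := by
  refine ⟨vanishingIdeal K (nonPropernessSet X f),
    (subset_zariskiClosure _).antisymm fun y hy => ?_⟩
  refine ⟨fun g hg => hy g fun z hz => hz.1 g hg, ?_⟩
  rintro ⟨U, ⟨C, ⟨I, rfl⟩, rfl⟩, hyU, hfin⟩
  refine hyU.2 fun c hc => hy c fun z hz => ?_
  by_contra hcz
  exact hz.2 ⟨_, ⟨_, ⟨I, rfl⟩, rfl⟩, ⟨hz.1, fun h => hcz (h c hc)⟩, hfin⟩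

theorem IsAffineVariety.zeroLocus_vanishingIdeal {Z : Set (σ → K)} (hZ : IsAffineVariety Z) :
    zeroLocus K (vanishingIdeal K Z) = Z := by
  obtain ⟨I, rfl⟩ := hZ
  exact (zeroLocus_anti_mono (le_vanishingIdeal_zeroLocus I)).antisymm
    (zeroLocus_vanishingIdeal_le _)

theorem IsIrreducibleVariety.isPrime_vanishingIdeal {Z : Set (σ → K)}
    (hZ : IsIrreducibleVariety Z) : (vanishingIdeal K Z).IsPrime := by
  obtain ⟨-, ⟨z, hz⟩, hirr⟩ := hZ
  refine Ideal.isPrime_iff.2 ⟨fun h => ?_, fun {a b} hab => ?_⟩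
  · have h1 : (1 : MvPolynomial σ K) ∈ vanishingIdeal K Z := h ▸ Submodule.mem_top
    simpa using h1 z hz
  · have key := hirr _ _ ⟨Ideal.span {a}, rfl⟩ ⟨Ideal.span {b}, rfl⟩ fun x hx => by
      have h1 := hab x hx
      rw [map_mul, mul_eq_zero] at h1
      simpa [zeroLocus_span] using h1
    simpa [zeroLocus_span, Set.subset_def] using key

theorem isIrreducibleVariety_zeroLocus [IsAlgClosed K] [Finite σ] (P : Ideal (MvPolynomial σ K))
    [hP : P.IsPrime] : IsIrreducibleVariety (zeroLocus K P) := by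
  refine ⟨⟨P, rfl⟩, ?_, ?_⟩
  · by_contra h
    have h1 := IsPrime.vanishingIdeal_zeroLocus (K := K) P
    rw [Set.not_nonempty_iff_eq_empty.1 h, vanishingIdeal_empty] at h1
    exact hP.ne_top h1.symm
  · rintro _ _ ⟨I, rfl⟩ ⟨J, rfl⟩ h
    have h1 : I * J ≤ P := by
      rw [← IsPrime.vanishingIdeal_zeroLocus (K := K) P]
      intro g hg x hx
      rcases h hx with h2 | h2
      · exact h2 g ((Ideal.mul_le_left : I * J ≤ I) hg)
      · exact h2 g ((Ideal.mul_le_right : I * J ≤ J) hg)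
    exact (hP.mul_le.1 h1).imp (fun h => zeroLocus_anti_mono h) fun h => zeroLocus_anti_mono h

/-- A dense subset `U` of `X` meets every component of `X`, since otherwise it would lie in the
union of the other components. -/
theorem exists_mem_zeroLocus_of_minimalPrimes [Finite σ] {X U : Set (σ → K)} (hUX : U ⊆ X)
    (hU : X ⊆ zariskiClosure U) {q : Ideal (MvPolynomial σ K)}
    (hq : q ∈ (vanishingIdeal K X).minimalPrimes) : ∃ a ∈ U, a ∈ zeroLocus K q := by
  have hqp : q.IsPrime := hq.1.1
  by_contra! hcon
  have hmin := (vanishingIdeal K X).finite_minimalPrimes_of_isNoetherianRing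
  have hex : ∀ q' : Ideal (MvPolynomial σ K), ∃ s ∉ q,
      q' ∈ (vanishingIdeal K X).minimalPrimes → q' ≠ q → s ∈ q' := by
    intro q'
    by_cases h : q' ∈ (vanishingIdeal K X).minimalPrimes ∧ q' ≠ q
    · obtain ⟨s, hs, hsq⟩ := Set.not_subset.1 fun hle : q' ≤ q =>
        h.2 (le_antisymm hle (hq.2 h.1.1 hle))
      exact ⟨s, hsq, fun _ _ => hs⟩
    · exact ⟨1, hqp.one_notMem, fun h1 h2 => absurd ⟨h1, h2⟩ h⟩
  choose s hs hs' using hex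
  have hprod : ∏ q' ∈ hmin.toFinset, s q' ∉ q := fun h => by
    obtain ⟨q', -, h1⟩ := hqp.prod_mem_iff.1 h
    exact hs q' h1
  refine hprod (hq.1.2 fun x hx => hU hx _ fun a ha => ?_)
  have haq := hcon a ha
  obtain ⟨q', hq', hle⟩ := Ideal.exists_minimalPrimes_le
    (vanishingIdeal_anti_mono (Set.singleton_subset_iff.2 (hUX ha)) :
      vanishingIdeal K X ≤ vanishingIdeal K {a})
  have hne : q' ≠ q := by
    rintro rfl
    exact haq fun g hg => hle hg a rfl
  rw [map_prod]
  exact Finset.prod_eq_zero (hmin.mem_toFinset.2 hq') (hle (hs' q' hq' hne) a rfl)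

theorem natDegree_aeval_le {A : Type*} [CommRing A] [Algebra K A] (w : σ → Polynomial A)
    (hw : ∀ i, (w i).natDegree ≤ 1) {d : ℕ} {g : MvPolynomial σ K} (hg : g.totalDegree ≤ d) :
    (aeval w g).natDegree ≤ d := by
  rw [← aeval_map_algebraMap A w g]
  simpa using aeval_natDegree_le (map (algebraMap K A) g) ((show
      (map (algebraMap K A) g).totalDegree ≤ g.totalDegree from
        Finset.sup_mono (support_map_subset _ _)).trans hg) w hw

/-! ### Lines in a cylinder -/

/-- The line through the point `a` in the direction of the `i₀`-th coordinate axis. -/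
noncomputable def lineAlong {A : Type*} [CommRing A] [DecidableEq σ] (i₀ : σ) (a : σ → A) :
    σ → Polynomial A :=
  fun i => Polynomial.C (a i) + if i = i₀ then Polynomial.X else 0

section Line

variable [DecidableEq σ] (i₀ : σ)

theorem eval_aeval_lineAlong {A : Type*} [CommRing A] [Algebra K A] (a : σ → A) (t : A)
    (g : MvPolynomial σ K) :
    (aeval (lineAlong i₀ a) g).eval t = aeval (a + Pi.single i₀ t) g := by
  refine (comp_aeval_apply (lineAlong i₀ a)
    ((Polynomial.aeval t).restrictScalars K : Polynomial A →ₐ[K] A) g).trans ?_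
  congr 2
  funext i
  by_cases hi : i = i₀ <;> simp [lineAlong, hi]

theorem aeval_lineAlong_eq_map {A : Type*} [CommRing A] [Algebra K A] (a : σ → A)
    (g : MvPolynomial σ K) :
    aeval (lineAlong i₀ a) g = (aeval (lineAlong i₀ (X : σ → MvPolynomial σ K)) g).map
      ((aeval a : MvPolynomial σ K →ₐ[K] A) : MvPolynomial σ K →+* A) := by
  rw [← aeval_polynomial_map]
  congr 2
  funext i
  by_cases hi : i = i₀ <;> simp [lineAlong, hi]

theorem coeff_aeval_lineAlong_mem [Infinite K] {i₀ : σ} {X : Set (σ → K)}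
    (hX : ∀ a ∈ X, ∀ t, a + Pi.single i₀ t ∈ X) {g : MvPolynomial σ K}
    (hg : g ∈ vanishingIdeal K X) (k : ℕ) :
    (aeval (lineAlong i₀ (MvPolynomial.X : σ → MvPolynomial σ K)) g).coeff k ∈
      vanishingIdeal K X := by
  intro a ha
  have h1 : aeval (lineAlong i₀ a) g = 0 := Polynomial.funext fun t => by
    rw [eval_aeval_lineAlong, Polynomial.eval_zero]
    exact hg _ (hX a ha t)
  rw [aeval_lineAlong_eq_map] at h1
  have h2 := congrArg (fun q => Polynomial.coeff q k) h1
  simp only [Polynomial.coeff_map, Polynomial.coeff_zero] at h2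
  exact h2

/-- Generic finiteness makes `f` nonconstant on the line through the generic point of a component
of `X` in the direction of a coordinate axis along which `X` is a cylinder. -/
theorem exists_coeff_notMem [Infinite K] [Finite σ] {i₀ : σ} {X : Set (σ → K)}
    (hX : ∀ a ∈ X, ∀ t, a + Pi.single i₀ t ∈ X) {f : (σ → K) → (τ → K)}
    {P : τ → MvPolynomial σ K} (hP : ∀ x ∈ X, ∀ j, f x j = eval x (P j))
    (hfin : IsGenericallyFinite X f) {q : Ideal (MvPolynomial σ K)}
    (hq : q ∈ (vanishingIdeal K X).minimalPrimes) :
    ∃ j k, 0 < k ∧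
      (aeval (lineAlong i₀ (MvPolynomial.X : σ → MvPolynomial σ K)) (P j)).coeff k ∉ q := by
  by_contra! hcon
  obtain ⟨_, ⟨_, ⟨I, rfl⟩, rfl⟩, hdense, hfib⟩ := hfin
  have hqp : q.IsPrime := hq.1.1
  -- the component of `X` defined by `q` meets the dense open set
  obtain ⟨a, ⟨haX, haI⟩, haq⟩ := exists_mem_zeroLocus_of_minimalPrimes Set.sdiff_subset hdense hq
  obtain ⟨c, hcI, hca⟩ : ∃ c ∈ I, eval a c ≠ 0 := by
    by_contra! h
    exact haI h
  have hconst : ∀ t, f (a + Pi.single i₀ t) = f a := by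
    intro t
    funext j
    rw [hP _ (hX a haX t), hP a haX]
    have h1 : (aeval (lineAlong i₀ a) (P j)).natDegree = 0 := by
      by_contra hne
      have hpos := Nat.pos_of_ne_zero hne
      have h2 := haq _ (hcon j _ hpos)
      rw [aeval_lineAlong_eq_map] at hpos
      have h3 : (aeval (lineAlong i₀ a) (P j)).leadingCoeff = 0 := by
        rw [Polynomial.leadingCoeff]
        nth_rewrite 1 [aeval_lineAlong_eq_map]
        rw [Polynomial.coeff_map]
        exact h2
      rw [aeval_lineAlong_eq_map, Polynomial.leadingCoeff_eq_zero] at h3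
      rw [h3] at hpos
      simp at hpos
    have h4 := Polynomial.eq_C_of_natDegree_eq_zero h1
    have h5 : ∀ s, eval (a + Pi.single i₀ s) (P j) =
        (aeval (lineAlong i₀ a) (P j)).coeff 0 := fun s => by
      have h6 := (eval_aeval_lineAlong i₀ a s (P j)).symm
      rw [h4, Polynomial.eval_C] at h6
      exact h6
    rw [h5 t, ← h5 0, Pi.single_zero, add_zero]
  -- all but finitely many points of the line lie in the open set
  let r := aeval (lineAlong i₀ a) c
  have hr0 : r ≠ 0 := by
    intro h
    have h1 := eval_aeval_lineAlong i₀ a 0 c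
    rw [Pi.single_zero, add_zero] at h1
    apply hca
    refine h1.symm.trans ?_
    change r.eval 0 = 0
    rw [h, Polynomial.eval_zero]
  have hinf : {t : K | r.eval t ≠ 0}.Infinite := by
    have : {t : K | r.eval t ≠ 0} = ({t | r.IsRoot t})ᶜ := rfl
    rw [this]
    exact (Polynomial.finite_setOfPred_isRoot hr0).infinite_compl
  refine hinf ((hfib (f a)).preimage (f := fun t => a + Pi.single i₀ t) ?_ |>.subset ?_)
  · exact fun s _ t _ hst => Pi.single_injective i₀ (add_left_cancel hst)
  · intro t ht
    refine ⟨⟨hX a haX t, fun h => ht ?_⟩, hconst t⟩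
    exact (eval_aeval_lineAlong i₀ a t c).trans (h c hcI)

end Line

/-! ### Curves in the components of the set of non-properness -/

/-- Some coordinate of the source is not integral over the local ring of the target at a given
irreducible set of points of non-properness. -/
theorem exists_coordinate_without_relations [IsAlgClosed K] [Finite σ] [Finite τ]
    {X : Set (σ → K)} (hX : IsAffineVariety X) {f : (σ → K) → (τ → K)}
    {P : τ → MvPolynomial σ K} (hP : ∀ x ∈ X, ∀ j, f x j = eval x (P j)) {Z : Set (τ → K)}
    (hZ : IsIrreducibleVariety Z) (hZS : Z ⊆ nonPropernessSet X f) :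
    ∃ i, ∀ H ∈ relations X P i, H.leadingCoeff ∈ vanishingIdeal K Z := by
  have := Fintype.ofFinite σ
  have hp := hZ.isPrime_vanishingIdeal
  by_contra! hcon
  choose H hH hHZ using hcon
  have hprod : ∏ i, (H i).leadingCoeff ∉ vanishingIdeal K Z := fun h => by
    obtain ⟨i, -, hi⟩ := hp.prod_mem_iff.1 h
    exact hHZ i hi
  obtain ⟨y, hyZ, hy⟩ : ∃ y ∈ Z, eval y (∏ i, (H i).leadingCoeff) ≠ 0 := by
    by_contra! h
    exact hprod h
  rw [map_prod, Finset.prod_ne_zero_iff] at hy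
  exact (hZS hyZ).2 (isProperAt_of_relations hX hP (hZS hyZ).1
    fun i => ⟨H i, hH i, hy i (Finset.mem_univ i)⟩)

/-- A coordinate that is not integral over the local ring at `p` is not integral on some component
of `X`: equations on the components multiply to an equation on `X`. -/
theorem exists_minimalPrime_without_relations [IsAlgClosed K] [Finite σ]
    {X : Set (σ → K)} (hX : IsAffineVariety X) {P : τ → MvPolynomial σ K}
    (p : Ideal (MvPolynomial τ K)) [hp : p.IsPrime] {i : σ}
    (hi : ∀ H ∈ relations X P i, H.leadingCoeff ∈ p) :
    ∃ q ∈ (vanishingIdeal K X).minimalPrimes, ∀ H : Polynomial (MvPolynomial τ K),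
      H.eval₂ (aeval P : MvPolynomial τ K →ₐ[K] MvPolynomial σ K).toRingHom
        (MvPolynomial.X i) ∈ q → H.leadingCoeff ∈ p := by
  by_contra! hcon
  have hmin := (vanishingIdeal K X).finite_minimalPrimes_of_isNoetherianRing
  have hcon' : ∀ q, ∃ H : Polynomial (MvPolynomial τ K), H.leadingCoeff ∉ p ∧
      (q ∈ (vanishingIdeal K X).minimalPrimes →
        H.eval₂ (aeval P : MvPolynomial τ K →ₐ[K] MvPolynomial σ K).toRingHom
          (MvPolynomial.X i) ∈ q) := by
    intro q
    by_cases hq : q ∈ (vanishingIdeal K X).minimalPrimes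
    · obtain ⟨H, h1, h2⟩ := hcon q hq
      exact ⟨H, h2, fun _ => h1⟩
    · exact ⟨1, by simpa using hp.one_notMem, fun h => absurd h hq⟩
  choose H hHp hHq using hcon'
  have hrad : (vanishingIdeal K X).radical = vanishingIdeal K X := by
    rw [← vanishingIdeal_zeroLocus_eq_radical (K := K), hX.zeroLocus_vanishingIdeal]
  have hmem : ∏ q ∈ hmin.toFinset, H q ∈ relations X P i := by
    change Polynomial.eval₂RingHom _ _ _ ∈ vanishingIdeal K X
    refine hrad.le ?_
    rw [← Ideal.sInf_minimalPrimes, map_prod, Submodule.mem_sInf]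
    intro q hq
    exact Ideal.mem_of_dvd q (Finset.dvd_prod_of_mem _ (hmin.mem_toFinset.2 hq)) (hHq q hq)
  have hlc := hi _ hmem
  rw [Polynomial.leadingCoeff_prod] at hlc
  obtain ⟨q, -, hq⟩ := hp.prod_mem_iff.1 hlc
  exact hHp q hq

/-- The generic point of the irreducible variety defined by `q`, over an algebraically closed
field. -/
theorem exists_generic_point.{u, v} {K : Type u} {σ : Type v} [Field K]
    (q : Ideal (MvPolynomial σ K)) [q.IsPrime] :
    ∃ (F : Type (max u v)) (_ : Field F) (_ : IsAlgClosed F) (_ : Algebra K F) (a : σ → F),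
      ∀ g : MvPolynomial σ K, aeval a g = 0 ↔ g ∈ q := by
  let A := MvPolynomial σ K ⧸ q
  let E := FractionRing A
  let r : MvPolynomial σ K →ₐ[K] AlgebraicClosure E :=
    ((IsScalarTower.toAlgHom K E (AlgebraicClosure E)).comp (IsScalarTower.toAlgHom K A E)).comp
      (Ideal.Quotient.mkₐ K q)
  refine ⟨AlgebraicClosure E, inferInstance, inferInstance, inferInstance, fun i => r (X i),
    fun g => ?_⟩
  have h1 : aeval (fun i => r (X i)) = r := (aeval_unique r).symm
  rw [h1, ← Ideal.Quotient.eq_zero_iff_mem]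
  change algebraMap E (AlgebraicClosure E) (algebraMap A E (Ideal.Quotient.mk q g)) = 0 ↔ _
  rw [map_eq_zero, IsFractionRing.to_map_eq_zero_iff]

/-- Let the `i`-th coordinate fail to be integral over the local ring at `p` on the component `q`.
The image under `f` of the line through the generic point of that component, in a direction other
than the `i`-th, degenerates to a nonconstant curve of degree at most `d` that starts at the
generic point of the zero locus of `p`. The `i`-th coordinate is constant along the line and is a
pole of the valuation ring, so the whole limit curve consists of points of non-properness. -/
theorem exists_curve_at_generic_point.{u} [IsAlgClosed K] [Finite σ] [Finite τ] [DecidableEq σ]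
    {X : Set (σ → K)} {i i₀ : σ} (hi₀ : i₀ ≠ i) (hline : ∀ a ∈ X, ∀ t, a + Pi.single i₀ t ∈ X)
    {f : (σ → K) → (τ → K)} {P : τ → MvPolynomial σ K}
    (hP : ∀ x ∈ X, ∀ j, f x j = eval x (P j)) {d : ℕ} (hd : ∀ j, (P j).totalDegree ≤ d)
    (hfin : IsGenericallyFinite X f) {q : Ideal (MvPolynomial σ K)}
    (hq : q ∈ (vanishingIdeal K X).minimalPrimes) {p : Ideal (MvPolynomial τ K)} [p.IsPrime]
    (hqp : ∀ H : Polynomial (MvPolynomial τ K),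
      H.eval₂ (aeval P : MvPolynomial τ K →ₐ[K] MvPolynomial σ K).toRingHom
        (MvPolynomial.X i) ∈ q → H.leadingCoeff ∈ p)
    {F : Type u} [Field F] [IsAlgClosed F] [Algebra K F] {a : σ → F}
    (haq : ∀ g : MvPolynomial σ K, aeval a g = 0 ↔ g ∈ q) :
    ∃ (κ : Type u) (_ : Field κ) (_ : Algebra K κ) (v : τ → Polynomial κ),
      (∀ j, (v j).natDegree ≤ d) ∧ (∃ j, 0 < (v j).natDegree) ∧
      (∀ g, aeval (fun j => (v j).coeff 0) g = 0 → g ∈ p) ∧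
      zeroLocus K (RingHom.ker (aeval v : MvPolynomial τ K →ₐ[K] Polynomial κ)) ⊆
        nonPropernessSet X f := by
  have hinf : Infinite K := IsAlgClosed.instInfinite
  let ρ : MvPolynomial τ K →+* F :=
    ((aeval a : MvPolynomial σ K →ₐ[K] F).comp (aeval P)).toRingHom
  obtain ⟨O, hO, hcen, hb0, hb⟩ := exists_valuationSubring_pole ρ p (a i) fun H hH => by
    refine hqp H ((haq _).1 ?_)
    have h1 := Polynomial.hom_eval₂ H (aeval P : MvPolynomial τ K →ₐ[K] _).toRingHom
      (aeval a : MvPolynomial σ K →ₐ[K] F).toRingHom (MvPolynomial.X i)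
    refine h1.trans ?_
    rw [← hH]
    congr 1
    exact aeval_X _ _
  -- the image under `f` of the line through the generic point
  let w : τ → Polynomial F := fun j => aeval (lineAlong i₀ a) (P j)
  have hw_aeval : ∀ g, aeval w g = aeval (lineAlong i₀ a) (aeval P g) := fun g =>
    (comp_aeval_apply P (aeval (lineAlong i₀ a)) g).symm
  have hw0 : ∀ g : MvPolynomial τ K, aeval (fun j => (w j).coeff 0) g = ρ g := by
    intro g
    have h1 : (fun j => (w j).coeff 0) = fun j => aeval a (P j) := by
      funext j
      rw [Polynomial.coeff_zero_eq_eval_zero, eval_aeval_lineAlong, Pi.single_zero, add_zero]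
    rw [h1]
    exact (comp_aeval_apply P (aeval a) g).symm
  have hwd : ∀ j, (w j).natDegree ≤ d := fun j =>
    natDegree_aeval_le _ (fun k => by
      refine (Polynomial.natDegree_C_add).le.trans ?_
      split_ifs
      · exact Polynomial.natDegree_X_le
      · simp) (hd j)
  have hwpos : ∃ j, 0 < (w j).natDegree := by
    obtain ⟨j, k, hk, hjk⟩ := exists_coeff_notMem hline hP hfin hq
    refine ⟨j, hk.trans_le (Polynomial.le_natDegree_of_ne_zero ?_)⟩
    change (aeval (lineAlong i₀ a) (P j)).coeff k ≠ 0
    rw [aeval_lineAlong_eq_map, Polynomial.coeff_map]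
    exact fun h => hjk ((haq _).1 h)
  have hkill : ∀ g ∈ vanishingIdeal K X, aeval (lineAlong i₀ a) g = 0 := by
    intro g hg
    rw [aeval_lineAlong_eq_map]
    ext k
    rw [Polynomial.coeff_map, Polynomial.coeff_zero]
    exact (haq _).2 (hq.1.2 (coeff_aeval_lineAlong_mem hline hg k))
  obtain ⟨_, _, c, w', hmap, hres, hd', hpos, h0⟩ :=
    exists_integral_model (K := K) O w hwd hwpos fun g => by rw [hw0]; exact hO g
  refine ⟨IsLocalRing.ResidueField O, inferInstance, inferInstance, _, hd', hpos,
    fun g hg => ?_, fun y hy => ⟨fun g hg => hy g ?_, fun hprop => ?_⟩⟩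
  · rw [h0, hw0] at hg
    exact (hcen g).2 hg
  · have h1 : aeval P g ∈ vanishingIdeal K X := fun z hz =>
      (eval_aeval_eq hP hz g).trans (hg _ ⟨z, hz, rfl⟩)
    have h2 : aeval w' g = 0 := by
      apply Polynomial.map_injective (algebraMap O F) Subtype.val_injective
      rw [hmap, hw_aeval, hkill _ h1, Polynomial.zero_comp, Polynomial.map_zero]
    rw [RingHom.mem_ker, hres, h2, Polynomial.map_zero]
  · obtain ⟨H, hH, hHy⟩ := exists_relation_of_isProperAt hP hprop i
    refine hHy (hy _ ?_)
    rw [RingHom.mem_ker, hres]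
    refine residue_leadingCoeff_eq_zero O (aeval w').toRingHom (a i) hb0 hb H ?_
    let Θ : MvPolynomial σ K →+* Polynomial F :=
      (Polynomial.compRingHom (Polynomial.C c * Polynomial.X)).comp
        (aeval (lineAlong i₀ a) : MvPolynomial σ K →ₐ[K] Polynomial F).toRingHom
    have h1 := Polynomial.hom_eval₂ H (aeval P : MvPolynomial τ K →ₐ[K] _).toRingHom Θ
      (MvPolynomial.X i)
    have h2 : Θ (H.eval₂ (aeval P : MvPolynomial τ K →ₐ[K] MvPolynomial σ K).toRingHom
        (MvPolynomial.X i)) = 0 :=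
      (congrArg (fun r => r.comp (Polynomial.C c * Polynomial.X)) (hkill _ hH)).trans
        Polynomial.zero_comp
    have h3 : Θ (MvPolynomial.X i) = Polynomial.C (a i) := by
      change (aeval (lineAlong i₀ a) (MvPolynomial.X i)).comp _ = _
      rw [aeval_X, lineAlong, if_neg hi₀.symm, add_zero, Polynomial.C_comp]
    rw [h2, h3] at h1
    rw [h1]
    congr 1
    refine RingHom.ext fun g => ?_
    refine (hmap g).trans ?_
    rw [hw_aeval]
    rfl

/-- Through every point of a component `Z` of the set of non-properness there passes a polynomial
curve of degree at most `d` inside `Z`, provided that `X` is a cylinder along at least two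
coordinate axes. -/
theorem exists_curve_in_component [IsAlgClosed K] [Finite σ] [Finite τ] [DecidableEq σ]
    {X : Set (σ → K)} (hX : IsAffineVariety X)
    (htrans : ∀ i, ∃ i₀ ≠ i, ∀ a ∈ X, ∀ t, a + Pi.single i₀ t ∈ X)
    {f : (σ → K) → (τ → K)} {P : τ → MvPolynomial σ K}
    (hP : ∀ x ∈ X, ∀ j, f x j = eval x (P j)) {d : ℕ} (hd : ∀ j, (P j).totalDegree ≤ d)
    (hfin : IsGenericallyFinite X f) {Z : Set (τ → K)}
    (hZ : IsComponent (nonPropernessSet X f) Z) {x : τ → K} (hx : x ∈ Z) :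
    ∃ φ : τ → Polynomial K, (∀ j, (φ j).natDegree ≤ d) ∧ (∃ j, 0 < (φ j).natDegree) ∧
      (∀ j, (φ j).coeff 0 = x j) ∧ ∀ g ∈ vanishingIdeal K Z, aeval φ g = 0 := by
  obtain ⟨⟨hZirr, hZS⟩, hZmax⟩ := hZ
  have hp : (vanishingIdeal K Z).IsPrime := hZirr.isPrime_vanishingIdeal
  obtain ⟨i, hi⟩ := exists_coordinate_without_relations hX hP hZirr hZS
  obtain ⟨q, hq, hqp⟩ := exists_minimalPrime_without_relations hX _ hi
  have hqprime : q.IsPrime := hq.1.1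
  obtain ⟨i₀, hi₀, hline⟩ := htrans i
  obtain ⟨F, _, _, _, a, haq⟩ := exists_generic_point q
  obtain ⟨κ, _, _, v, hvd, hvpos, hgen, hS⟩ :=
    exists_curve_at_generic_point hi₀ hline hP hd hfin hq hqp haq
  let N : Ideal (MvPolynomial τ K) := RingHom.ker (aeval v : MvPolynomial τ K →ₐ[K] Polynomial κ)
  have hN : N.IsPrime := RingHom.ker_isPrime _
  -- the curve starts at the generic point of `Z`, so its closure contains `Z`
  have hNp : N ≤ vanishingIdeal K Z := by
    intro g hg
    apply hgen
    have h1 : (aeval v g).coeff 0 = 0 := by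
      rw [RingHom.mem_ker.1 hg, Polynomial.coeff_zero]
    have h2 := (comp_aeval_apply v
      ((Polynomial.aeval (0 : κ)).restrictScalars K : Polynomial κ →ₐ[K] κ) g).symm
    simp only [Polynomial.coeff_zero_eq_eval_zero] at h1 ⊢
    exact h2.trans h1
  -- and it is contained in `Z` because `Z` is a component
  have hpN : vanishingIdeal K Z ≤ N := by
    have h1 : zeroLocus K N ⊆ Z := hZmax ⟨isIrreducibleVariety_zeroLocus N, hS⟩ (by
      have := zeroLocus_anti_mono (K := K) hNp
      rwa [hZirr.1.zeroLocus_vanishingIdeal] at this)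
    rw [← IsPrime.vanishingIdeal_zeroLocus (K := K) N]
    exact vanishingIdeal_anti_mono h1
  exact exists_curve_through v hvd hvpos (fun g hg => hpN hg) hgen (fun g hg => hg x hx)

end AffineGeometry

theorem mainTheorem7 {K : Type*} [Field K] [IsAlgClosed K] {n m : ℕ}
    (W : Set (Fin n → K)) (hW : AffineGeometry.IsAffineVariety W)
    (f : (Fin 2 ⊕ Fin n → K) → (Fin m → K)) (d : ℕ)
    (hf : AffineGeometry.IsPolynomialMapOfDegree (AffineGeometry.cylinder W) f d)
    (hfin : AffineGeometry.IsGenericallyFinite (AffineGeometry.cylinder W) f) :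
    AffineGeometry.nonPropernessSet (AffineGeometry.cylinder W) f = ∅ ∨
      AffineGeometry.HasUniruledDegreeLE
        (AffineGeometry.nonPropernessSet (AffineGeometry.cylinder W) f) d := by
  obtain ⟨⟨P, hPd, hP⟩, -⟩ := hf
  refine Or.inr ⟨AffineGeometry.isAffineVariety_nonPropernessSet _ _, fun Z hZ x hx => ?_⟩
  have htrans : ∀ i : Fin 2 ⊕ Fin n, ∃ i₀ ≠ i, ∀ a ∈ AffineGeometry.cylinder W, ∀ t,
      a + Pi.single i₀ t ∈ AffineGeometry.cylinder W := by
    have hl : ∀ l : Fin 2, ∀ a ∈ AffineGeometry.cylinder W, ∀ t,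
        a + Pi.single (Sum.inl l) t ∈ AffineGeometry.cylinder W := by
      intro l a ha t
      simpa [AffineGeometry.cylinder] using ha
    intro i
    by_cases hi : i = Sum.inl 0
    · exact ⟨Sum.inl 1, by simp [hi], hl 1⟩
    · exact ⟨Sum.inl 0, Ne.symm hi, hl 0⟩
  have hX : AffineGeometry.IsAffineVariety (AffineGeometry.cylinder W) := by
    obtain ⟨I, rfl⟩ := hW
    refine ⟨I.map (rename Sum.inr : MvPolynomial (Fin n) K →ₐ[K] _), ?_⟩
    rw [Ideal.map, zeroLocus_span]
    ext a
    refine forall₂_congr (fun g _ => ?_) |>.trans Set.forall_mem_image.symm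
    rw [aeval_rename]
    rfl
  obtain ⟨φ, hφd, hφpos, hφ0, hφZ⟩ :=
    AffineGeometry.exists_curve_in_component hX htrans hP hPd hfin hZ hx
  refine ⟨_, ⟨φ, hφd, hφpos, rfl⟩, AffineGeometry.subset_zariskiClosure _ ⟨0, ?_⟩, ?_⟩
  · funext j
    exact (Polynomial.coeff_zero_eq_eval_zero (φ j)).symm.trans (hφ0 j)
  · intro y hy
    rw [← hZ.prop.1.1.zeroLocus_vanishingIdeal]
    refine fun g hg => hy g ?_
    rintro _ ⟨t, rfl⟩
    have h1 := comp_aeval_apply φ (Polynomial.aeval t : Polynomial K →ₐ[K] K) g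
    rw [hφZ g hg, map_zero] at h1
    exact h1.symm
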